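/- For an integer $j\ge 0$ let $H_j=\mathrm{Sym}^j(\mathbb C^2)\subset(\mathbb C^2)^{\otimes j}$ be the Hilbert space of symmetric tensors and let $\pi_j$ be the irreducible unitary representation of $\mathrm{SU}(2)$ on $H_j$ obtained by restricting $u\mapsto u^{\otimes j}$ (so $j$ is the Dynkin label, the spin is $j/2$ and $\dim H_j=j+1$). For integers $j,k,l\ge 0$ let $\mathbb P^l_{j,k}$ be the orthogonal projection of $H_j\otimes H_k$ onto the isotypic component of type $\pi_l$ of the diagonal representation $u\mapsto\pi_j(u)\otimes\pi_k(u)$ of $\mathrm{SU}(2)$, and define the quasicharacter $$\chi^l_{j,k}(u,v)=\mathrm{Tr}\big(\mathbb P^l_{j,k}\,(\pi_j(u)\otimes\pi_k(v))\big),\qquad u,v\in \mathrm{SU}(2).$$ Then $\chi^1_{1,0}(u,v)=\mathrm{Tr}(u)$, and for every integer $j\ge 0$ and all $u,v\in\mathrm{SU}(2)$, $$\chi^1_{1,0}(u,v)\,\chi^{j+1}_{j,1}(u,v)=\chi^{j+2}_{j+1,1}(u,v)+\frac{1}{(j+1)^2}\,\chi^{j}_{j+1,1}(u,v)+\frac{j(j+2)}{(j+1)^2}\,\chi^{j}_{j-1,1}(u,v)+0\cdot\chi^{j-2}_{j-1,1}(u,v),$$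 where a term whose labels include a negative number is read as $0$ (this concerns the third term for $j=0$ and the fourth term for $j\le 1$; their coefficients vanish anyway). Moreover, the coefficients of this expansion are uniquely determined: if complex numbers $c_1,c_2,c_3,c_4$ satisfy $$\chi^1_{1,0}\,\chi^{j+1}_{j,1}=c_1\chi^{j+2}_{j+1,1}+c_2\chi^{j}_{j+1,1}+c_3\chi^{j}_{j-1,1}+c_4\chi^{j-2}_{j-1,1}$$ on $\mathrm{SU}(2)\times\mathrm{SU}(2)$, then $c_1=1$, $c_2=\frac1{(j+1)^2}$, $c_3=\frac{j(j+2)}{(j+1)^2}$ if $j\ge1$, and $c_4=0$ if $j\ge 2$. -/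

import Mathlib

open scoped TensorProduct

namespace Quasicharacter

noncomputable section

/-- The compact group `SU(2)`. -/
abbrev SU2 : Type := Matrix.specialUnitaryGroup (Fin 2) ℂ

/-- The tensor power `(ℂ²)^{⊗ j}` as a Hilbert space: a tensor is given by its components
`x (a₁, …, a_j)`, with `a_i ∈ {0, 1}`, in the standard orthonormal basis. -/
abbrev TensorPower (j : ℕ) : Type := EuclideanSpace ℂ (Fin j → Fin 2)

/-- The matrix of `m ⊗ ⋯ ⊗ m` (`j` factors). -/
def tensorPowerMatrix (j : ℕ) (m : Matrix (Fin 2) (Fin 2) ℂ) :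
    Matrix (Fin j → Fin 2) (Fin j → Fin 2) ℂ :=
  Matrix.of fun a b => ∏ i, m (a i) (b i)

theorem tensorPowerMatrix_one (j : ℕ) : tensorPowerMatrix j 1 = 1 := by
  ext a b
  simp only [tensorPowerMatrix, Matrix.of_apply, Matrix.one_apply, Finset.prod_ite_zero,
    Finset.prod_const_one, Finset.mem_univ, true_implies, funext_iff]

theorem tensorPowerMatrix_mul (j : ℕ) (m n : Matrix (Fin 2) (Fin 2) ℂ) :
    tensorPowerMatrix j (m * n) = tensorPowerMatrix j m * tensorPowerMatrix j n := by
  ext a b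
  simp only [tensorPowerMatrix, Matrix.of_apply, Matrix.mul_apply, Finset.prod_univ_sum,
    Fintype.piFinset_univ, Finset.prod_mul_distrib]

/-- The symmetric tensors in `(ℂ²)^{⊗ j}`, i.e. those invariant under all permutations of the
tensor factors. -/
def symmetricTensors (j : ℕ) : Submodule ℂ (TensorPower j) where
  carrier := {x | ∀ (σ : Equiv.Perm (Fin j)) (a : Fin j → Fin 2), x (a ∘ σ) = x a}
  add_mem' hx hy σ a := by simp [hx σ a, hy σ a]
  zero_mem' σ a := by simp
  smul_mem' c x hx σ a := by simp [hx σ a]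

theorem tensorPowerMatrix_mem (j : ℕ) (m : Matrix (Fin 2) (Fin 2) ℂ) (x : TensorPower j)
    (hx : x ∈ symmetricTensors j) :
    Matrix.toEuclideanLin (tensorPowerMatrix j m) x ∈ symmetricTensors j := by
  intro σ a
  simp only [Matrix.toLpLin_apply, Matrix.mulVec, dotProduct, tensorPowerMatrix, Matrix.of_apply]
  refine Fintype.sum_equiv (Equiv.arrowCongr σ (Equiv.refl (Fin 2))) _ _ fun b => ?_
  congr 1
  · rw [← Equiv.prod_comp σ (fun i => m (a i) (_))]
    simp
  · exact (hx σ.symm b).symm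

/-- The Hilbert space `H_j` of Dynkin label `j` (spin `j/2`, dimension `j + 1`): the symmetric
tensors, with the inner product inherited from `(ℂ²)^{⊗ j}`. -/
def H (j : ℕ) : Type := symmetricTensors j

instance (j : ℕ) : NormedAddCommGroup (H j) :=
  inferInstanceAs (NormedAddCommGroup (symmetricTensors j))

instance (j : ℕ) : InnerProductSpace ℂ (H j) :=
  inferInstanceAs (InnerProductSpace ℂ (symmetricTensors j))

instance (j : ℕ) : FiniteDimensional ℂ (H j) :=
  inferInstanceAs (FiniteDimensional ℂ (symmetricTensors j))

/-- The linear map that `m ⊗ ⋯ ⊗ m` induces on the symmetric tensors. -/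
def symmetricPower (j : ℕ) (m : Matrix (Fin 2) (Fin 2) ℂ) : H j →ₗ[ℂ] H j :=
  (Matrix.toEuclideanLin (tensorPowerMatrix j m)).restrict (tensorPowerMatrix_mem j m)

theorem symmetricPower_one (j : ℕ) : symmetricPower j 1 = 1 := by
  refine LinearMap.ext fun x => Subtype.ext ?_
  change Matrix.toEuclideanLin (tensorPowerMatrix j 1) x.1 = x.1
  simp [tensorPowerMatrix_one]

theorem symmetricPower_mul (j : ℕ) (m n : Matrix (Fin 2) (Fin 2) ℂ) :
    symmetricPower j (m * n) = symmetricPower j m * symmetricPower j n := by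
  refine LinearMap.ext fun x => Subtype.ext ?_
  change Matrix.toEuclideanLin (tensorPowerMatrix j (m * n)) x.1 =
    Matrix.toEuclideanLin (tensorPowerMatrix j m) (Matrix.toEuclideanLin (tensorPowerMatrix j n) x.1)
  simp [tensorPowerMatrix_mul]

/-- The irreducible representation `π_j` of `SU(2)` of spin `j/2`: the restriction of
`u ⊗ ⋯ ⊗ u` to the symmetric tensors. -/
def rep (j : ℕ) : Representation ℂ SU2 (H j) where
  toFun u := symmetricPower j (u : Matrix (Fin 2) (Fin 2) ℂ)
  map_one' := symmetricPower_one j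
  map_mul' u v := symmetricPower_mul j u v

/-- The isotypic component of Dynkin label `l` of the diagonal representation
`u ↦ π_j(u) ⊗ π_k(u)` of `SU(2)` on `H_j ⊗ H_k`: the sum of the images of all
`SU(2)`-equivariant linear maps `H_l → H_j ⊗ H_k`. It is zero if `H_l` does not occur. -/
def isotypicComponent (j k l : ℕ) : Submodule ℂ (H j ⊗[ℂ] H k) :=
  ⨆ f : Representation.IntertwiningMap (rep l) ((rep j).tprod (rep k)),
    LinearMap.range f.toLinearMap

/-- The projector `ℙ^l_{j,k}`: the orthogonal projection of the Hilbert space `H_j ⊗ H_k` onto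
its isotypic component of Dynkin label `l`. -/
def projector (j k l : ℕ) : (H j ⊗[ℂ] H k) →ₗ[ℂ] (H j ⊗[ℂ] H k) :=
  ((isotypicComponent j k l).starProjection : (H j ⊗[ℂ] H k) →L[ℂ] (H j ⊗[ℂ] H k))

/-- The irreducible quasicharacter `χ^l_{j,k}(u, v) = Tr(ℙ^l_{j,k} ∘ (π_j(u) ⊗ π_k(v)))`
for `N = 2`, in Dynkin labels; the arguments are in the order `j k l`. -/
def chi (j k l : ℕ) (u v : SU2) : ℂ :=
  LinearMap.trace ℂ (H j ⊗[ℂ] H k)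
    (projector j k l ∘ₗ TensorProduct.map (rep j u) (rep k v))

end

end Quasicharacter

/-! On symmetric tensors, contraction with a basis covector (`slice`) and symmetrized multiplication
by a basis vector (`mul`) obey the canonical commutation relations. They make the projection of `H n
⊗ H 1` onto its top component explicit, as `symmetrizer n`; for n ≥ 1 the remainder lies in a copy
of `H (n - 1)`, orthogonal to the top one by `intertwiningMap_eq_zero`. Hence χ^{n+1}_{n,1}(u,v) =
tr(v M_n(u))/(n+1) with M_n = `traceMatrix n`, and the lower quasicharacter is the full trace minus
this one.

The commutation relations yield M_{n+1} = Tr π_{n+1}(u)·1 + u M_n. With t = tr u and S_n the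
rescaled Chebyshev polynomials, the solution is Tr π_n(u) = S_n(t), M_n = S'_{n+1}(t)·1 - S'_n(t)
u⁻¹ (`trace_rep_and_traceMatrix`). The expansion then follows from the differentiated Chebyshev
recursion and `X_mul_derivative_S`.

For uniqueness, a quarter turn v isolates a relation between derivatives S'_n and v = 1 one between
the S_n; these have distinct degrees (`chi_linearIndependent`). -/

namespace Quasicharacter

noncomputable section

/-! ### Creation and annihilation operators on symmetric tensors. -/

/-- The component of a symmetric tensor at a multi-index. -/
def coord {n : ℕ} (a : Fin n → Fin 2) : H n →ₗ[ℂ] ℂ where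
  toFun x := x.1 a
  map_add' _ _ := rfl
  map_smul' _ _ := rfl

@[ext]
theorem H.ext {n : ℕ} {x y : H n} (h : ∀ a, coord a x = coord a y) : x = y :=
  Subtype.ext (PiLp.ext h)

theorem coord_comp_perm {n : ℕ} (x : H n) (σ : Equiv.Perm (Fin n)) (a : Fin n → Fin 2) :
    coord (a ∘ σ) x = coord a x := x.2 σ a

/-- The symmetric tensor with prescribed components. -/
def ofCoord {n : ℕ} (f : (Fin n → Fin 2) → ℂ)
    (hf : ∀ (σ : Equiv.Perm (Fin n)) (a : Fin n → Fin 2), f (a ∘ σ) = f a) : H n :=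
  ⟨WithLp.toLp 2 f, hf⟩

@[simp]
theorem coord_ofCoord {n : ℕ} (f : (Fin n → Fin 2) → ℂ) (hf) (a : Fin n → Fin 2) :
    coord a (ofCoord f hf) = f a := rfl

theorem coord_rep {n : ℕ} (u : SU2) (x : H n) (a : Fin n → Fin 2) :
    coord a (rep n u x) = ∑ b, (∏ i, u.1 (a i) (b i)) * coord b x := by
  change (Matrix.toEuclideanLin (tensorPowerMatrix n u.1) x.1) a = _
  simp only [Matrix.toLpLin_apply, Matrix.mulVec, dotProduct, tensorPowerMatrix, Matrix.of_apply]
  rfl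

/-- Two ways of removing the same index from a multi-index are related by a permutation. -/
theorem coord_comp_eq_of_avoid {n : ℕ} (x : H n) (a : Fin (n + 1) → Fin 2) (p : Fin (n + 1))
    (f : Fin n → Fin (n + 1)) (hf : Function.Injective f) (hp : ∀ k, f k ≠ p) :
    coord (a ∘ f) x = coord (a ∘ p.succAbove) x := by
  choose τ hτ using fun k => Fin.exists_succAbove_eq (hp k)
  have hinj : Function.Injective τ := fun k l h => hf (by rw [← hτ k, ← hτ l, h])
  have := coord_comp_perm x (Equiv.ofBijective τ (Finite.injective_iff_bijective.1 hinj))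
    (a ∘ p.succAbove)
  rw [← this]
  congr 2
  ext k
  simp [hτ]

/-- Contraction of one tensor factor with the `b`-th coordinate: the annihilation operator. -/
def slice (n : ℕ) (b : Fin 2) : H (n + 1) →ₗ[ℂ] H n where
  toFun x := ofCoord (fun a => coord (Fin.cons b a) x) fun σ a => by
    -- Extend σ to a permutation fixing the contracted slot 0.
    rw [← coord_comp_perm x (Equiv.Perm.decomposeFin.symm (0, σ)) (Fin.cons b a)]
    congr 2
    funext i
    refine Fin.cases ?_ (fun k => ?_) i <;> simp
  map_add' x y := by ext a; simp
  map_smul' c x := by ext a; simp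

/-- Unnormalized symmetrized product with the `b`-th basis vector: the creation operator. -/
def mul (n : ℕ) (b : Fin 2) : H n →ₗ[ℂ] H (n + 1) where
  toFun x := ofCoord (fun a => ∑ i, if a i = b then coord (a ∘ i.succAbove) x else 0)
    fun σ a => by
      rw [← Equiv.sum_comp σ fun i => if a i = b then coord (a ∘ i.succAbove) x else 0]
      refine Finset.sum_congr rfl fun i _ => ?_
      have := coord_comp_eq_of_avoid x a (σ i) (σ ∘ i.succAbove)
        (σ.injective.comp Fin.succAbove_right_injective) (fun k => by simp)
      simp only [Function.comp_apply, ← this]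
      rfl
  map_add' x y := by
    ext a
    simp only [map_add, coord_ofCoord, ← Finset.sum_add_distrib]
    exact Finset.sum_congr rfl fun i _ => by split_ifs <;> simp
  map_smul' c x := by
    ext a
    simp [Finset.mul_sum]

theorem coord_slice {n : ℕ} (b : Fin 2) (x : H (n + 1)) (a : Fin n → Fin 2) :
    coord a (slice n b x) = coord (Fin.cons b a) x := rfl

theorem coord_mul {n : ℕ} (b : Fin 2) (x : H n) (a : Fin (n + 1) → Fin 2) :
    coord a (mul n b x) = ∑ i, if a i = b then coord (a ∘ i.succAbove) x else 0 := rfl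

theorem slice_mul_zero (b c : Fin 2) (x : H 0) :
    slice 0 b (mul 0 c x) = if b = c then x else 0 := by
  ext a
  rw [coord_slice, coord_mul]
  simp only [Fin.sum_univ_succ, Finset.univ_eq_empty, Finset.sum_empty, add_zero, Fin.cons_zero]
  split_ifs
  · congr 2
  · simp

/-- The canonical commutation relation. -/
theorem slice_mul_succ (n : ℕ) (b c : Fin 2) (x : H (n + 1)) :
    slice (n + 1) b (mul (n + 1) c x) = (if b = c then x else 0) + mul n c (slice n b x) := by
  ext a
  rw [coord_slice, coord_mul, Fin.sum_univ_succ, map_add, coord_mul]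
  congr 1
  · simp only [Fin.cons_zero]
    split_ifs
    · congr 1
    · simp
  · refine Finset.sum_congr rfl fun i _ => ?_
    simp only [Fin.cons_succ]
    split_ifs
    · rw [coord_slice]
      congr 2
      ext k
      refine Fin.cases ?_ (fun k => ?_) k <;> simp
    · rfl

/-- The number operator: each of the n + 1 slots contributes x itself, since moving that slot to the
front is a permutation. -/
theorem sum_mul_slice (n : ℕ) (x : H (n + 1)) :
    ∑ b, mul n b (slice n b x) = ((n : ℂ) + 1) • x := by
  ext a
  simp only [map_sum, coord_mul, coord_slice]
  rw [Finset.sum_comm]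
  have h : ∀ i : Fin (n + 1), coord (Fin.cons (a i) (a ∘ i.succAbove)) x = coord a x := fun i => by
    rw [← coord_comp_perm x i.cycleRange, Fin.cons_comp_cycleRange]
    congr 2
    exact Fin.insertNth_self_removeNth i a
  simp [h]

theorem slice_rep (n : ℕ) (c : Fin 2) (u : SU2) (x : H (n + 1)) :
    slice n c (rep (n + 1) u x) = ∑ b, u.1 c b • rep n u (slice n b x) := by
  ext a
  simp only [map_sum, map_smul, coord_slice, coord_rep, smul_eq_mul]
  rw [← (Fin.consEquiv fun _ => Fin 2).sum_comp, Fintype.sum_prod_type]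
  simp [Fin.consEquiv, Fin.prod_univ_succ, Finset.mul_sum, mul_assoc]

theorem rep_mul (n : ℕ) (b : Fin 2) (u : SU2) (x : H n) :
    rep (n + 1) u (mul n b x) = ∑ c, u.1 c b • mul n c (rep n u x) := by
  ext a
  simp only [map_sum, map_smul, coord_mul, coord_rep, smul_eq_mul, Finset.mul_sum]
  rw [Finset.sum_comm, Finset.sum_comm (s := (Finset.univ : Finset (Fin 2)))]
  refine Finset.sum_congr rfl fun k _ => ?_
  rw [← (Fin.insertNthEquiv (fun _ => Fin 2) k).sum_comp, Fintype.sum_prod_type]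
  simp only [Fin.insertNthEquiv_apply, Fin.prod_univ_succAbove _ k, Fin.insertNth_apply_same,
    Fin.insertNth_apply_succAbove, mul_ite, mul_zero, Finset.sum_ite_irrel,
    Finset.sum_const_zero, Finset.sum_ite_eq, Finset.mem_univ, if_true,
    Finset.mul_sum, Finset.sum_ite_eq', mul_assoc]
  refine Finset.sum_congr rfl fun d _ => ?_
  congr 4
  ext i
  simp

/-! ### Explicit decomposition of `H n ⊗ H 1`. -/

/-- The standard basis vectors of `H 1 = ℂ²`. -/
def e (b : Fin 2) : H 1 :=
  ofCoord (fun a => if a 0 = b then 1 else 0) fun σ a => by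
    rw [Function.comp_apply, Subsingleton.elim (σ 0) 0]

theorem coord_e (a : Fin 1 → Fin 2) (b : Fin 2) : coord a (e b) = if a 0 = b then 1 else 0 := rfl

theorem sum_coord_smul_e (x : H 1) : ∑ b, coord (fun _ => b) x • e b = x := by
  ext a
  have ha : a = fun _ => a 0 := funext fun i => by rw [Subsingleton.elim i 0]
  simp only [map_sum, map_smul, coord_e, smul_eq_mul, mul_ite, mul_one, mul_zero,
    Finset.sum_ite_eq, Finset.mem_univ, if_true]
  rw [← ha]

theorem coord_rep_e (v : SU2) (b c : Fin 2) : coord (fun _ => c) (rep 1 v (e b)) = v.1 c b := by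
  rw [coord_rep, ← (Equiv.funUnique (Fin 1) (Fin 2)).symm.sum_comp]
  fin_cases b <;> simp [coord_e]

theorem rep_e (v : SU2) (b : Fin 2) : rep 1 v (e b) = ∑ c, v.1 c b • e c := by
  rw [← sum_coord_smul_e (rep 1 v (e b))]
  simp only [coord_rep_e]

/-- The matrix unit of `H 1` sending `e d` to `e c`. -/
def matrixUnit (c d : Fin 2) : H 1 →ₗ[ℂ] H 1 := (coord fun _ => d).smulRight (e c)

theorem matrixUnit_apply (c d : Fin 2) (x : H 1) :
    matrixUnit c d x = coord (fun _ => d) x • e c := rfl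

theorem trace_matrixUnit_rep (c d : Fin 2) (v : SU2) :
    LinearMap.trace ℂ (H 1) (matrixUnit c d ∘ₗ rep 1 v) = v.1 d c := by
  have : matrixUnit c d ∘ₗ rep 1 v = ((coord fun _ => d) ∘ₗ rep 1 v).smulRight (e c) := rfl
  rw [this, LinearMap.trace_smulRight, LinearMap.comp_apply, coord_rep_e]

/-- The projection of `H n ⊗ H 1` onto the copy of `H (n + 1)` in it. -/
def symmetrizer (n : ℕ) : H n ⊗[ℂ] H 1 →ₗ[ℂ] H n ⊗[ℂ] H 1 :=
  ((n : ℂ) + 1)⁻¹ • ∑ c, ∑ d, TensorProduct.map (slice n c ∘ₗ mul n d) (matrixUnit c d)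

/-- The embedding of `H (n + 1)` into `H n ⊗ H 1`. -/
def embedSucc (n : ℕ) : H (n + 1) →ₗ[ℂ] H n ⊗[ℂ] H 1 :=
  ∑ c, (TensorProduct.mk ℂ (H n) (H 1)).flip (e c) ∘ₗ slice n c

/-- The embedding of `H n` into `H (n + 1) ⊗ H 1`. -/
def embedPred (n : ℕ) : H n →ₗ[ℂ] H (n + 1) ⊗[ℂ] H 1 :=
  (TensorProduct.mk ℂ (H (n + 1)) (H 1)).flip (e 0) ∘ₗ mul n 1 -
    (TensorProduct.mk ℂ (H (n + 1)) (H 1)).flip (e 1) ∘ₗ mul n 0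

theorem embedSucc_apply (n : ℕ) (x : H (n + 1)) :
    embedSucc n x = ∑ c, slice n c x ⊗ₜ[ℂ] e c := by
  simp [embedSucc]

theorem embedPred_apply (n : ℕ) (x : H n) :
    embedPred n x = mul n 1 x ⊗ₜ[ℂ] e 0 - mul n 0 x ⊗ₜ[ℂ] e 1 := rfl

theorem embedSucc_rep (n : ℕ) (u : SU2) (x : H (n + 1)) :
    embedSucc n (rep (n + 1) u x) = (rep n).tprod (rep 1) u (embedSucc n x) := by
  simp only [embedSucc_apply, slice_rep, map_sum, Representation.tprod_apply,
    TensorProduct.map_tmul, rep_e, TensorProduct.tmul_sum, TensorProduct.sum_tmul,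
    TensorProduct.tmul_smul, TensorProduct.smul_tmul']
  exact Finset.sum_comm

theorem det_SU2 (u : SU2) : u.1 0 0 * u.1 1 1 - u.1 0 1 * u.1 1 0 = 1 := by
  rw [← Matrix.det_fin_two]
  exact (Matrix.mem_specialUnitaryGroup_iff.1 u.2).2

/-- The embedding pairs creation operators with the antisymmetric tensor on ℂ², which u multiplies
by det u = 1. -/
theorem embedPred_rep (n : ℕ) (u : SU2) (x : H n) :
    embedPred n (rep n u x) = (rep (n + 1)).tprod (rep 1) u (embedPred n x) := by
  simp only [embedPred_apply, map_sub, Representation.tprod_apply,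
    TensorProduct.map_tmul, rep_e, rep_mul, Fin.sum_univ_two, TensorProduct.tmul_add,
    TensorProduct.add_tmul, TensorProduct.tmul_smul, ← TensorProduct.smul_tmul']
  linear_combination (norm := module) (-det_SU2 u) •
    (mul n 1 (rep n u x) ⊗ₜ[ℂ] e 0 - mul n 0 (rep n u x) ⊗ₜ[ℂ] e 1)

theorem symmetrizer_tmul (n : ℕ) (x : H n) (b : Fin 2) :
    symmetrizer n (x ⊗ₜ e b) = ((n : ℂ) + 1)⁻¹ • embedSucc n (mul n b x) := by
  fin_cases b <;> simp [symmetrizer, embedSucc_apply, matrixUnit_apply, coord_e]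

theorem induction_tmul_e {n : ℕ} {p : H n ⊗[ℂ] H 1 → Prop} (x : H n ⊗[ℂ] H 1)
    (h : ∀ (y : H n) (b : Fin 2), p (y ⊗ₜ e b)) (hadd : ∀ y z, p y → p z → p (y + z)) : p x := by
  induction x with
  | zero => simpa using h 0 0
  | tmul x y =>
    rw [← sum_coord_smul_e y, Fin.sum_univ_two, TensorProduct.tmul_add, ← TensorProduct.smul_tmul,
      ← TensorProduct.smul_tmul]
    exact hadd _ _ (h _ _) (h _ _)
  | add x y hx hy => exact hadd _ _ hx hy

theorem symmetrizer_zero : symmetrizer 0 = LinearMap.id := by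
  refine LinearMap.ext fun x => ?_
  induction x using induction_tmul_e with
  | h y b => simp [symmetrizer_tmul, embedSucc_apply, slice_mul_zero, TensorProduct.ite_tmul]
  | hadd y z hy hz => rw [map_add, hy, hz, map_add]

theorem symmetrizer_mem_range (n : ℕ) (x : H n ⊗[ℂ] H 1) :
    symmetrizer n x ∈ LinearMap.range (embedSucc n) := by
  induction x using induction_tmul_e with
  | h y b =>
    rw [symmetrizer_tmul]
    exact Submodule.smul_mem _ _ ⟨_, rfl⟩
  | hadd y z hy hz => rw [map_add]; exact Submodule.add_mem _ hy hz

theorem sub_symmetrizer_mem_range (n : ℕ) (x : H (n + 1) ⊗[ℂ] H 1) :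
    x - symmetrizer (n + 1) x ∈ LinearMap.range (embedPred n) := by
  induction x using induction_tmul_e with
  | h y b =>
    have hn : ((n : ℂ) + 1 + 1) ≠ 0 := by exact_mod_cast Nat.succ_ne_zero (n + 1)
    -- The number operator and the commutation relation make the difference antisymmetric in b and
    -- c. The term c = b cancels; the other is ± `embedPred n` of a contraction of y.
    have key : y ⊗ₜ[ℂ] e b - symmetrizer (n + 1) (y ⊗ₜ e b) =
        ((n : ℂ) + 1 + 1)⁻¹ • (∑ c, mul n c (slice n c y) ⊗ₜ[ℂ] e b -
          ∑ c, mul n b (slice n c y) ⊗ₜ[ℂ] e c) := by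
      rw [← TensorProduct.sum_tmul, sum_mul_slice, symmetrizer_tmul, embedSucc_apply]
      simp only [slice_mul_succ, TensorProduct.add_tmul, Finset.sum_add_distrib,
        TensorProduct.ite_tmul, Finset.sum_ite_eq', Finset.mem_univ, if_true]
      push_cast
      rw [eq_inv_smul_iff₀ hn, smul_sub, smul_inv_smul₀ hn, ← TensorProduct.smul_tmul']
      module
    rw [key]
    refine Submodule.smul_mem _ _ ?_
    fin_cases b
    · refine ⟨slice n 1 y, ?_⟩
      simp [embedPred_apply, Fin.sum_univ_two]
    · refine ⟨-slice n 0 y, ?_⟩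
      simp [embedPred_apply, Fin.sum_univ_two, TensorProduct.neg_tmul, neg_add_eq_sub]
  | hadd y z hy hz =>
    rw [map_add, add_sub_add_comm]
    exact Submodule.add_mem _ hy hz

/-! ### Recursion for the trace matrix. -/

/-- The traces of `a_b ∘ a†_d ∘ π_n(u)`, for annihilation and creation operators `a_b`, `a†_d`. -/
def traceMatrix (n : ℕ) (u : SU2) : Matrix (Fin 2) (Fin 2) ℂ :=
  Matrix.of fun b d => LinearMap.trace ℂ (H n) (slice n b ∘ₗ mul n d ∘ₗ rep n u)

theorem trace_symmetrizer (n : ℕ) (u v : SU2) :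
    LinearMap.trace ℂ _ (symmetrizer n ∘ₗ TensorProduct.map (rep n u) (rep 1 v)) =
      ((n : ℂ) + 1)⁻¹ * (v.1 * traceMatrix n u).trace := by
  have h : symmetrizer n ∘ₗ TensorProduct.map (rep n u) (rep 1 v) =
      ((n : ℂ) + 1)⁻¹ • ∑ c, ∑ d, TensorProduct.map (slice n c ∘ₗ mul n d ∘ₗ rep n u)
        (matrixUnit c d ∘ₗ rep 1 v) :=
    TensorProduct.ext' fun x y => by simp [symmetrizer]
  rw [h]
  simp only [map_smul, map_sum, LinearMap.trace_tensorProduct', trace_matrixUnit_rep, smul_eq_mul]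
  congr 1
  simp only [Matrix.trace, Matrix.diag, Matrix.mul_apply, traceMatrix, Matrix.of_apply]
  rw [Finset.sum_comm]
  simp only [mul_comm]

theorem traceMatrix_zero (u : SU2) :
    traceMatrix 0 u = (LinearMap.trace ℂ (H 0) (rep 0 u)) • 1 := by
  ext b d
  have : slice 0 b ∘ₗ mul 0 d ∘ₗ rep 0 u = if b = d then rep 0 u else 0 := by
    refine LinearMap.ext fun x => ?_
    simp only [LinearMap.comp_apply, slice_mul_zero]
    split_ifs <;> rfl
  rw [traceMatrix, Matrix.of_apply, this]
  by_cases h : b = d <;> simp [h]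

/-- Commute a_b past a†_d, then a_b past π_{n+1}(u), which produces the row of u; cyclicity of the
trace brings the annihilator back to the front. -/
theorem traceMatrix_succ (n : ℕ) (u : SU2) :
    traceMatrix (n + 1) u =
      (LinearMap.trace ℂ (H (n + 1)) (rep (n + 1) u)) • 1 + u.1 * traceMatrix n u := by
  ext b d
  have h : slice (n + 1) b ∘ₗ mul (n + 1) d ∘ₗ rep (n + 1) u =
      (if b = d then rep (n + 1) u else 0) +
        ∑ c, u.1 b c • (mul n d ∘ₗ rep n u ∘ₗ slice n c) := by
    refine LinearMap.ext fun x => ?_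
    simp only [LinearMap.comp_apply, slice_mul_succ, slice_rep, LinearMap.add_apply,
      LinearMap.sum_apply, LinearMap.smul_apply, map_sum, map_smul]
    split_ifs <;> rfl
  have h' : ∀ c, LinearMap.trace ℂ _ (mul n d ∘ₗ rep n u ∘ₗ slice n c) =
      LinearMap.trace ℂ _ (slice n c ∘ₗ mul n d ∘ₗ rep n u) := fun c => by
    rw [← LinearMap.comp_assoc, LinearMap.trace_comp_comm']
  rw [traceMatrix, Matrix.of_apply, h]
  by_cases hbd : b = d <;> simp [traceMatrix, h', hbd, Matrix.mul_apply]

theorem sum_slice_mul (n : ℕ) (x : H n) :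
    ∑ b, slice n b (mul n b x) = ((n : ℂ) + 2) • x := by
  cases n with
  | zero => simp [slice_mul_zero, two_smul]
  | succ n =>
    simp only [slice_mul_succ, Finset.sum_add_distrib, sum_mul_slice, if_true]
    rw [Fin.sum_univ_two]
    push_cast
    module

theorem trace_traceMatrix (n : ℕ) (u : SU2) :
    (traceMatrix n u).trace = ((n : ℂ) + 2) * LinearMap.trace ℂ (H n) (rep n u) := by
  have : ∑ b, slice n b ∘ₗ mul n b ∘ₗ rep n u = ((n : ℂ) + 2) • rep n u := by
    refine LinearMap.ext fun x => ?_
    simp only [LinearMap.sum_apply, LinearMap.comp_apply, sum_slice_mul, LinearMap.smul_apply]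
  simp only [Matrix.trace, Matrix.diag, traceMatrix, Matrix.of_apply]
  rw [← map_sum, this, map_smul, smul_eq_mul]

theorem trace_rep_zero (u : SU2) : LinearMap.trace ℂ (H 0) (rep 0 u) = 1 := by
  let w : H 0 := ofCoord (fun _ => 1) fun _ _ => rfl
  have : rep 0 u = (coord Fin.elim0).smulRight w := by
    refine LinearMap.ext fun x => H.ext fun a => ?_
    rw [coord_rep, Subsingleton.elim a Fin.elim0]
    simp [w, Subsingleton.elim _ (Fin.elim0 : Fin 0 → Fin 2)]
  rw [this, LinearMap.trace_smulRight]
  rfl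

/-- Compare two values of tr M_{n+1}: n + 3 times the character by the number operator, and twice
the character plus tr(u M_n) by the recursion. Thus M_n determines the next character. -/
theorem trace_mul_traceMatrix (n : ℕ) (u : SU2) :
    (u.1 * traceMatrix n u).trace =
      ((n : ℂ) + 1) * LinearMap.trace ℂ (H (n + 1)) (rep (n + 1) u) := by
  have h := trace_traceMatrix (n + 1) u
  rw [traceMatrix_succ, Matrix.trace_add, Matrix.trace_smul, Matrix.trace_one] at h
  push_cast [Fintype.card_fin, smul_eq_mul] at h
  linear_combination h

/-! ### Unitarity, tensor powers and orthogonality of isotypic components. -/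

theorem inner_eq_sum {n : ℕ} (x y : H n) :
    inner ℂ x y = ∑ a, coord a y * star (coord a x) := by
  change inner ℂ x.1 y.1 = _
  rw [PiLp.inner_apply]
  rfl

theorem adjoint_rep (n : ℕ) (u : SU2) : LinearMap.adjoint (rep n u) = rep n u⁻¹ := by
  symm
  rw [LinearMap.eq_adjoint_iff]
  intro x y
  have hinv : ∀ a b, star ((u⁻¹ : SU2).1 a b) = u.1 b a := fun a b => by
    change star (star (u.1 b a)) = _
    simp
  simp only [inner_eq_sum, coord_rep, star_sum, star_mul', star_prod, hinv, Finset.mul_sum,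
    Finset.sum_mul]
  rw [Finset.sum_comm]
  refine Finset.sum_congr rfl fun a _ => Finset.sum_congr rfl fun b _ => ?_
  ring

theorem adjoint_tprod (j k : ℕ) (u : SU2) :
    LinearMap.adjoint ((rep j).tprod (rep k) u) = (rep j).tprod (rep k) u⁻¹ := by
  simp only [Representation.tprod_apply, TensorProduct.adjoint_map, adjoint_rep]

/-- The tensor power `z ⊗ ⋯ ⊗ z` of a vector `z`. -/
def powVec (n : ℕ) (z : Fin 2 → ℂ) : H n :=
  ofCoord (fun a => ∏ i, z (a i)) fun σ a => Equiv.prod_comp σ fun i => z (a i)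

theorem coord_powVec {n : ℕ} (z : Fin 2 → ℂ) (a : Fin n → Fin 2) :
    coord a (powVec n z) = ∏ i, z (a i) := rfl

theorem rep_powVec (n : ℕ) (u : SU2) (z : Fin 2 → ℂ) :
    rep n u (powVec n z) = powVec n (u.1.mulVec z) := by
  ext a
  simp only [coord_rep, coord_powVec, Matrix.mulVec, dotProduct, Finset.prod_univ_sum,
    Fintype.piFinset_univ, Finset.prod_mul_distrib]

theorem powVec_smul (n : ℕ) (r : ℂ) (z : Fin 2 → ℂ) :
    powVec n (r • z) = r ^ n • powVec n z := by
  ext a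
  simp [coord_powVec, Finset.prod_mul_distrib]

/-- The number of indices equal to `1` in a multi-index. -/
def weight {n : ℕ} (a : Fin n → Fin 2) : ℕ := Fintype.card {i // a i = 1}

/-- A bijection between the positions of the 1s extends to a permutation of all positions. -/
theorem coord_eq_of_weight_eq {n : ℕ} (x : H n) {a b : Fin n → Fin 2}
    (h : weight a = weight b) : coord a x = coord b x := by
  let τ : {i // b i = 1} ≃ {i // a i = 1} := Fintype.equivOfCardEq h.symm
  let σ := τ.extendSubtype
  rw [← coord_comp_perm x σ a]
  congr 2
  funext i
  by_cases hi : b i = 1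
  · rw [hi]
    exact τ.extendSubtype_mem i hi
  · have : a (σ i) ≠ 1 := τ.extendSubtype_not_mem i hi
    rw [Function.comp_apply]
    omega

theorem coord_powVec_one {n : ℕ} (t : ℂ) (a : Fin n → Fin 2) :
    coord a (powVec n ![1, t]) = t ^ weight a := by
  have h : ∀ b : Fin 2, (![1, t] : Fin 2 → ℂ) b = if b = 1 then t else 1 := fun b => by
    fin_cases b <;> simp
  simp only [coord_powVec, h, Finset.prod_ite, Finset.prod_const, one_pow, mul_one,
    weight, Fintype.card_subtype]

/-- A symmetric tensor orthogonal to all tensor powers is zero. -/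
theorem eq_zero_of_inner_powVec {n : ℕ} (x : H n)
    (h : ∀ t : ℂ, inner ℂ x (powVec n ![1, t]) = 0) : x = 0 := by
  -- The pairing is a polynomial in t; its coefficient at t^k is a positive multiple of the
  -- conjugate of the common coordinate of weight k, whenever that weight occurs.
  let p : Polynomial ℂ := ∑ a, Polynomial.monomial (weight a) (star (coord a x))
  have hp : p = 0 := Polynomial.funext fun t => by
    rw [Polynomial.eval_zero, ← h t, inner_eq_sum]
    simp [p, Polynomial.eval_finsetSum, coord_powVec_one, mul_comm]
  ext a
  have ha : p.coeff (weight a) = 0 := by rw [hp, Polynomial.coeff_zero]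
  have h' : ∀ b, (if weight b = weight a then star (coord b x) else 0) =
      if weight b = weight a then star (coord a x) else 0 := fun b => by
    split_ifs with hb
    · rw [coord_eq_of_weight_eq x hb]
    · rfl
  simp only [p, Polynomial.finsetSum_coeff, Polynomial.coeff_monomial, h'] at ha
  rw [← Finset.sum_filter, Finset.sum_const, smul_eq_zero, Finset.card_eq_zero] at ha
  rcases ha with ha | ha
  · have : a ∈ Finset.univ.filter fun b => weight b = weight a := by simp
    rw [ha] at this
    simp at this
  · simpa using ha

/-- The matrix with rows `(α, -conj β)` and `(β, conj α)`, as an element of `SU(2)`. -/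
def mkSU2 (α β : ℂ) (h : α * star α + β * star β = 1) : SU2 :=
  ⟨!![α, -star β; β, star α], by
    rw [Matrix.mem_specialUnitaryGroup_iff, Matrix.mem_unitaryGroup_iff]
    constructor
    · ext i j
      simp only [RCLike.star_def] at h
      fin_cases i <;> fin_cases j <;> simp [Matrix.mul_apply, Matrix.star_apply] <;>
        first | ring1 | linear_combination h
    · rw [Matrix.det_fin_two_of]
      linear_combination h⟩

theorem exists_rep_powVec (n : ℕ) (t : ℂ) :
    ∃ (u : SU2) (r : ℂ), r ≠ 0 ∧ rep n u (powVec n ![1, 0]) = r • powVec n ![1, t] := by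
  have hpos : 0 < 1 + Complex.normSq t := by
    linarith [Complex.normSq_nonneg t]
  let r : ℝ := (Real.sqrt (1 + Complex.normSq t))⁻¹
  have hr : r ≠ 0 := inv_ne_zero (Real.sqrt_pos.2 hpos).ne'
  have hr2 : r * r * (1 + Complex.normSq t) = 1 := by
    rw [← mul_inv, Real.mul_self_sqrt hpos.le, inv_mul_cancel₀ hpos.ne']
  have h : (r : ℂ) * star (r : ℂ) + (r * t) * star (r * t) = 1 := by
    have : (r : ℂ) * r * (1 + Complex.normSq t) = 1 := by exact_mod_cast hr2
    rw [← Complex.mul_conj] at this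
    simp only [RCLike.star_def, map_mul, Complex.conj_ofReal]
    linear_combination this
  refine ⟨mkSU2 r (r * t) h, (r : ℂ) ^ n, pow_ne_zero _ (by exact_mod_cast hr), ?_⟩
  rw [rep_powVec, ← powVec_smul]
  congr 1
  ext i
  fin_cases i <;> simp [mkSU2, Matrix.mulVec, dotProduct]

/-- There is no nonzero equivariant map from `H (m + 2)` to `H m`. -/
theorem intertwiningMap_eq_zero (m : ℕ) (g : H (m + 2) →ₗ[ℂ] H m)
    (hg : ∀ u x, g (rep (m + 2) u x) = rep m u (g x)) : g = 0 := by
  have htop : g (powVec (m + 2) ![1, 0]) = 0 := by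
    -- Test with diag(l, l⁻¹): the highest weight vector has eigenvalue l^(m+2), while those on `H
    -- m` are l^(2k-m) with k ≤ m. Order 2m + 3 keeps l^(2m+2) distinct from every l^(2k).
    have hprim := Complex.isPrimitiveRoot_exp (2 * m + 3) (by omega)
    set l := Complex.exp (2 * Real.pi * Complex.I / ((2 * m + 3 : ℕ) : ℂ)) with hl
    have hnorm : ‖l‖ = 1 := hprim.norm'_eq_one (by omega)
    have hl1 : l * star l = 1 := by
      rw [RCLike.star_def, Complex.mul_conj, Complex.normSq_eq_norm_sq, hnorm]
      simp
    let d := mkSU2 l 0 (by simpa using hl1)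
    have hd : rep (m + 2) d (powVec (m + 2) ![1, 0]) = l ^ (m + 2) • powVec (m + 2) ![1, 0] := by
      rw [rep_powVec, ← powVec_smul]
      congr 1
      ext i
      fin_cases i <;> simp [d, mkSU2, Matrix.mulVec, dotProduct]
    have hx := hg d (powVec (m + 2) ![1, 0])
    rw [hd, map_smul] at hx
    generalize g (powVec (m + 2) ![1, 0]) = x at hx ⊢
    ext a
    have ha : l ^ (m + 2) * coord a x = (∏ i, d.1 (a i) (a i)) * coord a x := by
      have := congrArg (coord a) hx
      rw [map_smul, smul_eq_mul, coord_rep] at this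
      rw [this]
      refine Finset.sum_eq_single a (fun b _ hb => ?_) (by simp)
      obtain ⟨i, hi⟩ := Function.ne_iff.1 hb
      rw [Finset.prod_eq_zero (Finset.mem_univ i), zero_mul]
      have key : ∀ p q : Fin 2, q ≠ p → d.1 p q = 0 := fun p q hpq => by
        fin_cases p <;> fin_cases q <;> simp [d, mkSU2] at hpq ⊢
      exact key _ _ hi
    have hprod : (∏ i, d.1 (a i) (a i)) * l ^ m =
        l ^ (2 * (Finset.univ.filter fun i => a i = 0).card) := by
      have h1 : ∀ p : Fin 2, d.1 p p * l = if p = 0 then l ^ 2 else 1 := fun p => by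
        fin_cases p
        · simp [d, mkSU2, sq]
        · simpa [d, mkSU2, mul_comm] using hl1
      have h2 : l ^ m = ∏ _i : Fin m, l := by simp
      rw [h2, ← Finset.prod_mul_distrib]
      simp only [h1, Finset.prod_ite, Finset.prod_const, one_pow, mul_one, pow_mul]
    have hcard : (Finset.univ.filter fun i => a i = 0).card ≤ m := by
      simpa using Finset.card_filter_le (Finset.univ : Finset (Fin m)) fun i => a i = 0
    rw [map_zero]
    by_contra hne
    have heq := mul_right_cancel₀ hne ha
    have : l ^ (2 * m + 2) = l ^ (2 * (Finset.univ.filter fun i => a i = 0).card) := by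
      rw [← hprod, ← heq]
      ring
    have := hprim.pow_inj (by omega) (by omega) this
    omega
  -- Translates of the highest weight vector reach every such power up to a scalar.
  have hall : ∀ t : ℂ, g (powVec (m + 2) ![1, t]) = 0 := fun t => by
    obtain ⟨u, r, hr, hu⟩ := exists_rep_powVec (m + 2) t
    have := hg u (powVec (m + 2) ![1, 0])
    rw [hu, htop, map_zero, map_smul] at this
    exact (smul_eq_zero.1 this).resolve_left hr
  have hadj : LinearMap.adjoint g = 0 := LinearMap.ext fun y =>
    eq_zero_of_inner_powVec _ fun t => by
      rw [LinearMap.adjoint_inner_left, hall, inner_zero_right]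
  rw [← LinearMap.adjoint_adjoint g, hadj, map_zero]

/-- For equivariant f and g, unitarity makes f* g an equivariant map from `H (m + 2)` to `H m`,
hence zero. -/
theorem isOrtho_isotypicComponent (j k m : ℕ) :
    isotypicComponent j k m ⟂ isotypicComponent j k (m + 2) := by
  simp only [isotypicComponent, Submodule.isOrtho_iSup_left, Submodule.isOrtho_iSup_right]
  intro g f
  have h : LinearMap.adjoint f.toLinearMap ∘ₗ g.toLinearMap = 0 := by
    refine intertwiningMap_eq_zero m _ fun u x => ?_
    have hf : LinearMap.adjoint f.toLinearMap ∘ₗ (rep j).tprod (rep k) u =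
        rep m u ∘ₗ LinearMap.adjoint f.toLinearMap := by
      have := congrArg LinearMap.adjoint (f.isIntertwining' u⁻¹)
      rw [LinearMap.adjoint_comp, LinearMap.adjoint_comp, adjoint_rep, adjoint_tprod,
        inv_inv] at this
      exact this.symm
    have h1 : g.toLinearMap (rep (m + 2) u x) = (rep j).tprod (rep k) u (g.toLinearMap x) :=
      g.isIntertwining _ _ u x
    rw [LinearMap.comp_apply, h1]
    exact LinearMap.congr_fun hf (g.toLinearMap x)
  rw [Submodule.isOrtho_iff_inner_eq]
  rintro _ ⟨x, rfl⟩ _ ⟨y, rfl⟩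
  rw [← LinearMap.adjoint_inner_right]
  have := LinearMap.congr_fun h y
  rw [LinearMap.comp_apply] at this
  rw [this, LinearMap.zero_apply, inner_zero_right]

theorem range_le_isotypicComponent {j k l : ℕ} (f : H l →ₗ[ℂ] H j ⊗[ℂ] H k)
    (hf : ∀ u x, f (rep l u x) = (rep j).tprod (rep k) u (f x)) :
    LinearMap.range f ≤ isotypicComponent j k l :=
  le_iSup (fun f : Representation.IntertwiningMap (rep l) ((rep j).tprod (rep k)) =>
    LinearMap.range f.toLinearMap) (f.intertwiningMap_of_isIntertwiningMap _ _ hf)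

/-! ### Projectors and quasicharacters as traces. -/

theorem projector_succ (n : ℕ) : projector n 1 (n + 1) = symmetrizer n := by
  refine LinearMap.ext fun x => ?_
  have hmem : symmetrizer n x ∈ isotypicComponent n 1 (n + 1) :=
    range_le_isotypicComponent _ (embedSucc_rep n) (symmetrizer_mem_range n x)
  refine (Submodule.eq_starProjection_of_mem_orthogonal hmem ?_)
  cases n with
  | zero => simp [symmetrizer_zero]
  | succ n =>
    exact (isOrtho_isotypicComponent (n + 1) 1 n)
      (range_le_isotypicComponent _ (embedPred_rep n) (sub_symmetrizer_mem_range n x))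

theorem projector_pred (n : ℕ) :
    projector (n + 1) 1 n = LinearMap.id - symmetrizer (n + 1) := by
  refine LinearMap.ext fun x => ?_
  have hmem : x - symmetrizer (n + 1) x ∈ isotypicComponent (n + 1) 1 n :=
    range_le_isotypicComponent _ (embedPred_rep n) (sub_symmetrizer_mem_range n x)
  refine (Submodule.eq_starProjection_of_mem_orthogonal hmem ?_)
  rw [LinearMap.sub_apply, LinearMap.id_apply, sub_sub_cancel]
  exact (isOrtho_isotypicComponent (n + 1) 1 n).symm
    (range_le_isotypicComponent _ (embedSucc_rep (n + 1)) (symmetrizer_mem_range (n + 1) x))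

theorem trace_rep_one (v : SU2) : LinearMap.trace ℂ (H 1) (rep 1 v) = v.1.trace := by
  have : rep 1 v = ∑ c, matrixUnit c c ∘ₗ rep 1 v := LinearMap.ext fun x => by
    simp only [LinearMap.sum_apply, LinearMap.comp_apply, matrixUnit_apply, sum_coord_smul_e]
  rw [this, map_sum]
  simp only [trace_matrixUnit_rep]
  rfl

theorem chi_succ (n : ℕ) (u v : SU2) :
    chi n 1 (n + 1) u v = ((n : ℂ) + 1)⁻¹ * (v.1 * traceMatrix n u).trace := by
  rw [chi, projector_succ, trace_symmetrizer]

theorem chi_pred (n : ℕ) (u v : SU2) :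
    chi (n + 1) 1 n u v = LinearMap.trace ℂ (H (n + 1)) (rep (n + 1) u) * v.1.trace -
      chi (n + 1) 1 (n + 2) u v := by
  rw [chi, chi, projector_pred, projector_succ (n + 1), LinearMap.sub_comp, map_sub,
    LinearMap.id_comp, LinearMap.trace_tensorProduct', trace_rep_one]

theorem chi_zero_one_zero (u v : SU2) : chi 0 1 0 u v = 0 := by
  have h : isotypicComponent 0 1 0 = ⊥ := by
    refine iSup_eq_bot.2 fun f => LinearMap.range_eq_bot.2 <| LinearMap.ext fun x => ?_
    -- The central element -1 acts by 1 on `H 0` but by -1 on `H 0 ⊗ H 1`.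
    let d := mkSU2 (-1) 0 (by simp)
    have h1 : rep 0 d x = x := by
      ext a
      rw [coord_rep, Fintype.sum_subsingleton _ a]
      simp
    have h2 : (rep 0).tprod (rep 1) d (f x) = -f x := by
      induction f x using induction_tmul_e with
      | h y b =>
        have hy : rep 0 d y = y := by
          ext a
          rw [coord_rep, Fintype.sum_subsingleton _ a]
          simp
        rw [Representation.tprod_apply, TensorProduct.map_tmul, hy, rep_e]
        fin_cases b <;> simp [d, mkSU2, TensorProduct.tmul_neg]
      | hadd y z hy hz => rw [map_add, hy, hz, neg_add]
    have h3 := f.isIntertwining _ _ d x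
    rw [h1, h2, eq_neg_iff_add_eq_zero, ← two_smul ℂ] at h3
    exact (smul_eq_zero.1 h3).resolve_left two_ne_zero
  simp [chi, projector, h]

theorem chi_one_zero_one (u v : SU2) : chi 1 0 1 u v = u.1.trace := by
  let w : H 0 := ofCoord (fun _ => 1) fun _ _ => rfl
  have hw : ∀ u, rep 0 u w = w := fun u => by
    ext a
    rw [coord_rep, Fintype.sum_subsingleton _ a]
    simp
  have h : isotypicComponent 1 0 1 = ⊤ := by
    refine top_le_iff.1 (le_trans ?_ (range_le_isotypicComponent
      ((TensorProduct.mk ℂ (H 1) (H 0)).flip w) fun u x => ?_))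
    · rintro x -
      induction x with
      | zero => exact Submodule.zero_mem _
      | tmul x y =>
        refine ⟨coord Fin.elim0 y • x, ?_⟩
        have : y = coord Fin.elim0 y • w := by
          ext a
          simp [w, Subsingleton.elim a Fin.elim0]
        conv_rhs => rw [this]
        simp
      | add x y hx hy => exact Submodule.add_mem _ hx hy
    · simp [hw]
  have hid : projector 1 0 1 = LinearMap.id := by
    refine LinearMap.ext fun x => Submodule.starProjection_eq_self_iff.2 ?_
    rw [h]
    trivial
  rw [chi, hid, LinearMap.id_comp, LinearMap.trace_tensorProduct', trace_rep_one, trace_rep_zero,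
    mul_one]

/-! ### Chebyshev polynomials and closed forms. -/

open Polynomial

theorem S_natCast_add_two (n : ℕ) :
    Chebyshev.S ℂ (n + 2 : ℕ) = X * Chebyshev.S ℂ (n + 1 : ℕ) - Chebyshev.S ℂ n := by
  push_cast
  exact Chebyshev.S_add_two ℂ n

theorem derivative_S_add_two (n : ℕ) :
    derivative (Chebyshev.S ℂ (n + 2 : ℕ)) = Chebyshev.S ℂ (n + 1 : ℕ) +
      X * derivative (Chebyshev.S ℂ (n + 1 : ℕ)) - derivative (Chebyshev.S ℂ n) := by
  rw [S_natCast_add_two, derivative_sub, derivative_mul, derivative_X, one_mul]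

/-- Euler's relation for the homogenization of the rescaled Chebyshev polynomials. -/
theorem X_mul_derivative_S (n : ℕ) :
    X * derivative (Chebyshev.S ℂ (n + 1 : ℕ)) - 2 * derivative (Chebyshev.S ℂ n) =
      ((n : ℂ[X]) + 1) * Chebyshev.S ℂ (n + 1 : ℕ) := by
  induction n using Nat.twoStepInduction with
  | zero => simp
  | one =>
    rw [derivative_S_add_two 0, S_natCast_add_two 0]
    simp
    ring
  | more n h0 h1 =>
    have e3 := S_natCast_add_two (n + 1)
    have d3 := derivative_S_add_two (n + 1)
    have d2 := derivative_S_add_two n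
    push_cast at *
    simp only [add_assoc, one_add_one_eq_two, show (1 : ℤ) + 2 = 3 by norm_num,
      show (2 : ℤ) + 1 = 3 by norm_num] at *
    linear_combination X * d3 - 2 * d2 + X * h1 - h0 - ((n : ℂ[X]) + 3) * e3

theorem coeff_S (n : ℕ) :
    (Chebyshev.S ℂ n).coeff n = 1 ∧ ∀ k, n < k → (Chebyshev.S ℂ n).coeff k = 0 := by
  induction n using Nat.twoStepInduction with
  | zero =>
    refine ⟨by simp, fun k hk => ?_⟩
    simp [coeff_one, hk.ne']
  | one =>
    refine ⟨by simp, fun k hk => ?_⟩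
    simp [coeff_X, hk.ne]
  | more n h0 h1 =>
    rw [S_natCast_add_two]
    refine ⟨?_, fun k hk => ?_⟩
    · rw [coeff_sub, coeff_X_mul, h1.1, h0.2 _ (by omega), sub_zero]
    · obtain ⟨k, rfl⟩ : ∃ k', k = k' + 1 := ⟨k - 1, by omega⟩
      rw [coeff_sub, coeff_X_mul, h1.2 _ (by omega), h0.2 _ (by omega), sub_zero]

theorem eq_zero_of_S_add_S {m : ℕ} {α β : ℂ}
    (h : C α * Chebyshev.S ℂ (m + 2 : ℕ) + C β * Chebyshev.S ℂ m = 0) : α = 0 ∧ β = 0 := by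
  have hα : α = 0 := by
    have := congrArg (fun p => coeff p (m + 2)) h
    simpa only [coeff_add, coeff_C_mul, (coeff_S (m + 2)).1, (coeff_S m).2 (m + 2) (by omega),
      mul_one, mul_zero, add_zero, coeff_zero] using this
  refine ⟨hα, ?_⟩
  simpa [hα, (coeff_S m).1] using congrArg (fun p => coeff p m) h

theorem eq_zero_of_derivative_S_add {m : ℕ} {α β : ℂ}
    (h : C α * derivative (Chebyshev.S ℂ (m + 2 : ℕ)) + C β * derivative (Chebyshev.S ℂ m) = 0) :
    α = 0 ∧ (m ≠ 0 → β = 0) := by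
  have hα : α = 0 := by
    have := congrArg (fun p => coeff p (m + 1)) h
    simp only [coeff_add, coeff_C_mul, coeff_derivative, (coeff_S (m + 2)).1,
      (coeff_S m).2 (m + 1 + 1) (by omega), coeff_zero, one_mul, zero_mul, mul_zero,
      add_zero] at this
    exact (mul_eq_zero.1 this).resolve_right (by exact_mod_cast Nat.succ_ne_zero (m + 1))
  refine ⟨hα, fun hm => ?_⟩
  obtain ⟨k, rfl⟩ := Nat.exists_eq_succ_of_ne_zero hm
  have := congrArg (fun p => coeff p k) h
  simp only [coeff_add, coeff_C_mul, coeff_derivative, hα, zero_mul, zero_add, coeff_zero] at this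
  rw [(coeff_S (k + 1)).1, one_mul] at this
  exact (mul_eq_zero.1 this).resolve_right (by exact_mod_cast Nat.succ_ne_zero k)

/-- Cayley–Hamilton for `SU(2)`. -/
theorem SU2_mul_trace_sub (u : SU2) : u.1 * (u.1.trace • 1 - u.1) = 1 := by
  have h := det_SU2 u
  ext i j
  fin_cases i <;> fin_cases j <;>
    simp [Matrix.mul_apply, Matrix.trace, Fin.sum_univ_two] <;> first | ring1 | linear_combination h

/-- The character of `H n` and the trace matrix, through the rescaled Chebyshev polynomials. -/
theorem trace_rep_and_traceMatrix (n : ℕ) (u : SU2) :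
    LinearMap.trace ℂ (H n) (rep n u) = (Chebyshev.S ℂ n).eval u.1.trace ∧
      traceMatrix n u = (derivative (Chebyshev.S ℂ (n + 1 : ℕ))).eval u.1.trace • 1 -
        (derivative (Chebyshev.S ℂ n)).eval u.1.trace • (u.1.trace • 1 - u.1) := by
  induction n with
  | zero => simp [trace_rep_zero, traceMatrix_zero]
  | succ n ih =>
    have hM := ih.2
    have hn : (n : ℂ) + 1 ≠ 0 := Nat.cast_add_one_ne_zero n
    have hchar : LinearMap.trace ℂ (H (n + 1)) (rep (n + 1) u) =
        (Chebyshev.S ℂ (n + 1 : ℕ)).eval u.1.trace := by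
      refine mul_left_cancel₀ hn ?_
      have hE := congrArg (eval u.1.trace) (X_mul_derivative_S n)
      simp only [eval_sub, eval_mul, eval_X, eval_add, eval_natCast, eval_one, eval_ofNat] at hE
      -- By Cayley–Hamilton, tr(u M_n) = t S'_{n+1}(t) - 2 S'_n(t), the left side of Euler's
      -- relation.
      rw [← trace_mul_traceMatrix, hM, ← hE, Matrix.mul_sub, Matrix.mul_smul, Matrix.mul_smul,
        SU2_mul_trace_sub, mul_one, Matrix.trace_sub, Matrix.trace_smul, Matrix.trace_smul,
        Matrix.trace_one]
      simp only [Fintype.card_fin, smul_eq_mul]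
      push_cast
      ring
    refine ⟨hchar, ?_⟩
    have hd := congrArg (eval u.1.trace) (derivative_S_add_two n)
    simp only [eval_sub, eval_mul, eval_X, eval_add] at hd
    rw [traceMatrix_succ, hM, hchar, hd, Matrix.mul_sub, Matrix.mul_smul, Matrix.mul_smul,
      SU2_mul_trace_sub, mul_one]
    module

theorem chi_succ_eq (n : ℕ) (u v : SU2) :
    chi n 1 (n + 1) u v = ((derivative (Chebyshev.S ℂ (n + 1 : ℕ))).eval u.1.trace * v.1.trace -
      (derivative (Chebyshev.S ℂ n)).eval u.1.trace *
        (u.1.trace * v.1.trace - (v.1 * u.1).trace)) / ((n : ℂ) + 1) := by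
  rw [chi_succ, (trace_rep_and_traceMatrix n u).2, Matrix.mul_sub, Matrix.mul_smul, Matrix.mul_smul,
    Matrix.mul_sub, Matrix.mul_smul, mul_one, Matrix.trace_sub, Matrix.trace_smul,
    Matrix.trace_smul, Matrix.trace_sub, Matrix.trace_smul, div_eq_inv_mul]
  rfl

/-- The two projectors sum to the identity. At n = 0 truncated subtraction gives label (0, 1; 0),
whose quasicharacter vanishes, so the formula persists. -/
theorem chi_pred_eq (n : ℕ) (u v : SU2) :
    chi n 1 (n - 1) u v =
      (Chebyshev.S ℂ n).eval u.1.trace * v.1.trace - chi n 1 (n + 1) u v := by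
  cases n with
  | zero => simp [chi_zero_one_zero, chi_succ_eq]
  | succ n =>
    rw [Nat.add_sub_cancel, chi_pred, (trace_rep_and_traceMatrix (n + 1) u).1]

theorem chi_mul_chi (j : ℕ) (u v : SU2) :
    chi 1 0 1 u v * chi j 1 (j + 1) u v =
      chi (j + 1) 1 (j + 2) u v
        + (1 / ((j : ℂ) + 1) ^ 2) * chi (j + 1) 1 j u v
        + ((j : ℂ) * ((j : ℂ) + 2) / ((j : ℂ) + 1) ^ 2) * chi (j - 1) 1 j u v := by
  have hpred := chi_pred_eq (j + 1) u v
  rw [Nat.add_sub_cancel] at hpred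
  rw [chi_one_zero_one, hpred, show j + 2 = j + 1 + 1 from rfl]
  cases j with
  | zero =>
    simp [chi_succ_eq]
  | succ m =>
    rw [Nat.add_sub_cancel, chi_succ_eq, chi_succ_eq (m + 1 + 1), chi_succ_eq m]
    have h1 : (m : ℂ) + 1 ≠ 0 := Nat.cast_add_one_ne_zero m
    have h2 : (m : ℂ) + 1 + 1 ≠ 0 := by exact_mod_cast Nat.succ_ne_zero (m + 1)
    have h3 : (m : ℂ) + 2 + 1 ≠ 0 := by exact_mod_cast Nat.succ_ne_zero (m + 2)
    have E1 := congrArg (eval u.1.trace) (X_mul_derivative_S (m + 1))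
    have E0 := congrArg (eval u.1.trace) (X_mul_derivative_S m)
    have D1 := congrArg (eval u.1.trace) (derivative_S_add_two (m + 1))
    have D0 := congrArg (eval u.1.trace) (derivative_S_add_two m)
    simp only [eval_sub, eval_mul, eval_X, eval_add, eval_natCast, eval_one, eval_ofNat,
      Nat.cast_add (R := ℂ), Nat.cast_one (R := ℂ), show m + 1 + 1 = m + 2 from rfl,
      show m + 1 + 2 = m + 3 from rfl,
      Nat.cast_ofNat (R := ℂ)] at *
    linear_combination (norm := (field_simp; ring1))
      -- The coefficients of tr v and of tr(v u⁻¹) match separately: one needs the Euler relation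
      -- and the differentiated recursion at m + 1, the other the same pair at m.
      (v.1.trace * (E1 - ((m : ℂ) + 1) * D1) -
        (u.1.trace * v.1.trace - (v.1 * u.1).trace) * (E0 - ((m : ℂ) + 1) * D0)) /
        ((m : ℂ) + 1 + 1) ^ 2

/-! ### Uniqueness of the coefficients. -/

theorem eq_zero_of_eval_eq_zero {p : ℂ[X]}
    (h : ∀ x : ℝ, x ∈ Set.Ioo (-1) 1 → p.eval (2 * (x : ℂ)) = 0) : p = 0 := by
  refine eq_zero_of_infinite_isRoot p (((Set.Ioo_infinite (show (-1 : ℝ) < 1 by norm_num)).image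
    (f := fun x : ℝ => 2 * (x : ℂ)) fun x _ y _ hxy => ?_).mono ?_)
  · simpa using hxy
  · rintro _ ⟨x, hx, rfl⟩
    exact h x hx

/-- Linear independence, up to the term that vanishes for `m = 0`, of the four quasicharacters. -/
theorem chi_linearIndependent (m : ℕ) (d₁ d₂ d₃ d₄ : ℂ)
    (h : ∀ u v : SU2, d₁ * chi (m + 2) 1 (m + 3) u v + d₂ * chi (m + 2) 1 (m + 1) u v +
      d₃ * chi m 1 (m + 1) u v + d₄ * chi m 1 (m - 1) u v = 0) :
    d₁ = 0 ∧ d₂ = 0 ∧ d₃ = 0 ∧ (m ≠ 0 → d₄ = 0) := by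
  have hpred : ∀ u v, chi (m + 2) 1 (m + 1) u v = _ := chi_pred_eq (m + 2)
  have h1 : (m : ℂ) + 1 ≠ 0 := Nat.cast_add_one_ne_zero m
  have h3 : (m : ℂ) + 2 + 1 ≠ 0 := by exact_mod_cast Nat.succ_ne_zero (m + 2)
  have hrot : ∀ x : ℝ, x ∈ Set.Ioo (-1) 1 → ∃ (y : ℂ) (u : SU2), y ≠ 0 ∧
      u.1 = !![(x : ℂ), -y; y, (x : ℂ)] := fun x hx => by
    have hpos : 0 < 1 - x ^ 2 := by nlinarith [hx.1, hx.2]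
    have hsq : ((Real.sqrt (1 - x ^ 2) : ℝ) : ℂ) * (Real.sqrt (1 - x ^ 2) : ℝ) = 1 - x ^ 2 := by
      exact_mod_cast Real.mul_self_sqrt hpos.le
    refine ⟨(Real.sqrt (1 - x ^ 2) : ℝ), mkSU2 x (Real.sqrt (1 - x ^ 2) : ℝ) ?_,
      by exact_mod_cast (Real.sqrt_pos.2 hpos).ne', ?_⟩
    · simp only [RCLike.star_def, Complex.conj_ofReal]
      linear_combination hsq
    · simp [mkSU2]
  -- Take u a real rotation and v the quarter turn: tr v = 0 removes the character terms, and tr(v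
  -- u⁻¹) = 2y is nonzero on the open interval.
  have hderiv : C ((d₁ - d₂) / ((m : ℂ) + 2 + 1)) * derivative (Chebyshev.S ℂ (m + 2 : ℕ)) +
      C ((d₃ - d₄) / ((m : ℂ) + 1)) * derivative (Chebyshev.S ℂ m) = 0 := by
    refine eq_zero_of_eval_eq_zero fun x hx => ?_
    obtain ⟨y, u, hy, hu⟩ := hrot x hx
    have huv := h u (mkSU2 0 1 (by simp))
    have hT : u.1.trace = 2 * (x : ℂ) := by
      rw [hu, Matrix.trace_fin_two_of]
      ring
    have hv : (mkSU2 0 1 (by simp)).1.trace = 0 := by simp [mkSU2, Matrix.trace_fin_two_of]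
    have huv' : ((mkSU2 0 1 (by simp)).1 * u.1).trace = -2 * y := by
      rw [hu]
      simp [mkSU2, Matrix.trace_fin_two_of]
      ring
    rw [hpred, chi_pred_eq m, chi_succ_eq m, chi_succ_eq (m + 2), hT, hv, huv'] at huv
    refine mul_left_cancel₀ (mul_ne_zero two_ne_zero hy) ?_
    simp only [eval_add, eval_mul, eval_C]
    push_cast at huv ⊢
    linear_combination -huv
  obtain ⟨h12, h34⟩ := eq_zero_of_derivative_S_add hderiv
  have h12 : d₁ = d₂ := sub_eq_zero.1 ((div_eq_zero_iff.1 h12).resolve_right h3)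
  have h34 : m ≠ 0 → d₃ = d₄ := fun hm =>
    sub_eq_zero.1 ((div_eq_zero_iff.1 (h34 hm)).resolve_right h1)
  have hS : C d₁ * Chebyshev.S ℂ (m + 2 : ℕ) + C d₃ * Chebyshev.S ℂ m = 0 := by
    refine eq_zero_of_eval_eq_zero fun x hx => ?_
    obtain ⟨y, u, hy, hu⟩ := hrot x hx
    have hT : u.1.trace = 2 * (x : ℂ) := by
      rw [hu, Matrix.trace_fin_two_of]
      ring
    have huv := h u 1
    have hv : (1 : SU2).1.trace = 2 := by simp
    -- For m = 0 the derivative relation says nothing about d₄, but its quasicharacter is zero.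
    have h34' : d₄ * chi m 1 (m - 1) u 1 = d₃ * chi m 1 (m - 1) u 1 := by
      rcases eq_or_ne m 0 with rfl | hm
      · simp [chi_zero_one_zero]
      · rw [h34 hm]
    rw [h34', ← h12, hpred, chi_pred_eq m, hv, hT] at huv
    simp only [eval_add, eval_mul, eval_C]
    linear_combination huv / 2
  obtain ⟨hd1, hd3⟩ := eq_zero_of_S_add_S hS
  exact ⟨hd1, h12 ▸ hd1, hd3, fun hm => h34 hm ▸ hd3⟩

theorem chi_one_linearIndependent (d₁ d₂ : ℂ)
    (h : ∀ u v : SU2, d₁ * chi 1 1 2 u v + d₂ * chi 1 1 0 u v = 0) : d₁ = 0 ∧ d₂ = 0 := by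
  have hpred : ∀ u v, chi 1 1 0 u v = _ := chi_pred_eq 1
  -- A rational rotation with nonzero sine and cosine suffices for two unknowns.
  let u := mkSU2 (3 / 5) (4 / 5) (by norm_num [← Complex.ofReal_ofNat, ← Complex.ofReal_div])
  have hu : u.1.trace = 6 / 5 := by
    simp [u, mkSU2, Matrix.trace_fin_two_of]
    norm_num
  have e1 := h u 1
  have e2 := h u (mkSU2 0 1 (by simp))
  have hv : (mkSU2 0 1 (by simp)).1.trace = 0 := by simp [mkSU2, Matrix.trace_fin_two_of]
  have huv : ((mkSU2 0 1 (by simp)).1 * u.1).trace = -8 / 5 := by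
    simp [u, mkSU2, Matrix.trace_fin_two_of]
    norm_num
  have h1 : (1 : SU2).1.trace = 2 := by simp
  rw [hpred, chi_succ_eq 1, hu, hv, huv] at e2
  have h12 : d₁ = d₂ := by
    simp at e2
    linear_combination (-5 / 4) * e2
  rw [hpred, ← h12, hu, h1] at e1
  simp at e1
  have hd1 : d₁ = 0 := by linear_combination (5 / 12) * e1
  exact ⟨hd1, h12 ▸ hd1⟩

end

end Quasicharacter

open Quasicharacter in
/-- Expansion of the pointwise product `χ^1_{1,0} · χ^{j+1}_{j,1}`, where `χ^1_{1,0}(u,v) = Tr u`,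
and uniqueness of the coefficients. Here `chi j k l` is `χ^l_{j,k}`. For `j = 0` the term of label
`(j-1, 1; j)`, and for `j ≤ 1` the term of label `(j-1, 1; j-2)`, is absent in the usual sense; in
the formula it has coefficient `0`. -/
theorem mainTheorem2 (j : ℕ) :
    (∀ u v : SU2, chi 1 0 1 u v = Matrix.trace (u : Matrix (Fin 2) (Fin 2) ℂ)) ∧
    (∀ u v : SU2,
      chi 1 0 1 u v * chi j 1 (j + 1) u v =
        chi (j + 1) 1 (j + 2) u v
          + (1 / ((j : ℂ) + 1) ^ 2) * chi (j + 1) 1 j u v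
          + ((j : ℂ) * ((j : ℂ) + 2) / ((j : ℂ) + 1) ^ 2) * chi (j - 1) 1 j u v
          + 0 * chi (j - 1) 1 (j - 2) u v) ∧
    (∀ c₁ c₂ c₃ c₄ : ℂ,
      (∀ u v : SU2,
        chi 1 0 1 u v * chi j 1 (j + 1) u v =
          c₁ * chi (j + 1) 1 (j + 2) u v + c₂ * chi (j + 1) 1 j u v
            + c₃ * chi (j - 1) 1 j u v + c₄ * chi (j - 1) 1 (j - 2) u v) →
      c₁ = 1 ∧ c₂ = 1 / ((j : ℂ) + 1) ^ 2 ∧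
        (1 ≤ j → c₃ = (j : ℂ) * ((j : ℂ) + 2) / ((j : ℂ) + 1) ^ 2) ∧
        (2 ≤ j → c₄ = 0)) := by
  refine ⟨chi_one_zero_one, fun u v => ?_, fun c₁ c₂ c₃ c₄ h => ?_⟩
  · rw [chi_mul_chi, zero_mul, add_zero]
  · have hdiff := fun u v => (chi_mul_chi j u v).symm.trans (h u v)
    cases j with
    | zero =>
      obtain ⟨h1, h2⟩ := chi_one_linearIndependent (c₁ - 1) (c₂ - 1) fun u v => by
        have := hdiff u v
        -- At j = 0 both truncated labels become (0, 1; 0), so c₃ and c₄ drop out.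
        simp [chi_zero_one_zero] at this
        linear_combination -this
      refine ⟨sub_eq_zero.1 h1, ?_, by simp, by simp⟩
      simpa using sub_eq_zero.1 h2
    | succ m =>
      obtain ⟨h1, h2, h3, h4⟩ := chi_linearIndependent m (c₁ - 1)
        (c₂ - 1 / (((m + 1 : ℕ) : ℂ) + 1) ^ 2)
        (c₃ - ((m + 1 : ℕ) : ℂ) * (((m + 1 : ℕ) : ℂ) + 2) / (((m + 1 : ℕ) : ℂ) + 1) ^ 2) c₄
        fun u v => by
          have := hdiff u v
          simp only [Nat.add_sub_cancel, show m + 1 - 2 = m - 1 by omega] at this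
          linear_combination -this
      exact ⟨sub_eq_zero.1 h1, sub_eq_zero.1 h2, fun _ => sub_eq_zero.1 h3,
        fun hj => h4 (by omega)⟩
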